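/- Let $S\subset\mathbb R^3$ be a closed set and let $\boldsymbol\mu=(\mu_1,\mu_2,\mu_3)\in\mathcal M(S)^3$, where $\mathcal M(S)$ denotes the space of finite signed Borel measures on $\mathbb R^3$ whose support lies in $S$. The magnetic field generated by $\boldsymbol\mu$ is, for $x\in\mathbb R^3$ outside the support of $\boldsymbol\mu$, $$\mathbf b(\boldsymbol\mu)(x)=-c\left(\int\frac{1}{|x-y|^3}\,d\boldsymbol\mu(y)-3\int (x-y)\,\frac{(x-y)\cdot d\boldsymbol\mu(y)}{|x-y|^5}\right),\qquad c=10^{-7}.$$ Call $\boldsymbol\mu$ *$S$-silent* if $\mathbf b(\boldsymbol\mu)$ vanishes on $\mathbb R^3\setminus S$, and *divergence-free* ($\operatorname{div}\boldsymbol\mu=0$) if $\sum_{i=1}^3\int\partial_{x_i}\varphi\,d\mu_i=0$ for every $\varphi\in C_c^\infty(\mathbb R^3)$. Call a closed set $S\subset\mathbb R^3$ *slender* if its Lebesgue measure is zero and each connected component of $\mathbb R^3\setminus S$ has infinite Lebesgue measure. 1. If $\operatorname{div}\boldsymbol\mu=0$, then $\boldsymbol\mu$ is $S$-silent. 2. If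 $S$ is slender and $\boldsymbol\mu$ is $S$-silent, then $\operatorname{div}\boldsymbol\mu=0$. -/

import Mathlib

open MeasureTheory
open scoped ContDiff

noncomputable section

namespace Magnetization

/-- Euclidean three-space. -/
abbrev E3 : Type := EuclideanSpace ℝ (Fin 3)

/-- `M(S)`: the finite signed Borel measures on `ℝ³` whose support lies in `S`. (A Mathlib signed
measure is automatically finite; its support is that of its total variation measure.) -/
def signedMeasuresOn (S : Set E3) : Set (SignedMeasure E3) :=
  {ν | ν.totalVariation.support ⊆ S}

/-- The partial derivative `∂ᵢ φ (y)`. -/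
def partialDeriv (i : Fin 3) (φ : E3 → ℝ) (y : E3) : ℝ :=
  fderiv ℝ φ y (EuclideanSpace.single i 1)

/-- The distributional divergence of an `ℝ³`-valued measure `μ = (μ₁, μ₂, μ₃)`, tested against `φ`:
`⟨φ, div μ⟩ = -∑ᵢ ∫ ∂ᵢφ dμᵢ`. -/
def distribDiv (μ : Fin 3 → SignedMeasure E3) (φ : E3 → ℝ) : ℝ :=
  -∑ i, ∫ᵛ y, partialDeriv i φ y ∂<•(μ i)

/-- `div μ = 0` in the sense of distributions: it vanishes on all of `C_c^∞(ℝ³)`. -/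
def IsDivergenceFree (μ : Fin 3 → SignedMeasure E3) : Prop :=
  ∀ φ : E3 → ℝ, ContDiff ℝ ∞ φ → HasCompactSupport φ → distribDiv μ φ = 0

/-- The physical constant `c = 10⁻⁷` (in henries per metre). -/
def fieldConst : ℝ := 1 / 10 ^ 7

/-- The magnetic field generated by `μ`; meaningful at points `x` outside the support of `μ`:
`b(μ)(x) = -c (∫ |x-y|⁻³ dμ(y) - 3 ∫ (x-y) ((x-y)·dμ(y)) / |x-y|⁵)`. -/
def magneticField (μ : Fin 3 → SignedMeasure E3) (x : E3) : E3 :=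
  WithLp.toLp 2 fun i =>
    -fieldConst * ((∫ᵛ y, 1 / ‖x - y‖ ^ 3 ∂<•(μ i))
      - 3 * ∑ j, ∫ᵛ y, (x - y) i * (x - y) j / ‖x - y‖ ^ 5 ∂<•(μ j))

/-- `μ` and `ν` are `S`-equivalent if their magnetic fields agree off `S`. -/
def SEquivalent (S : Set E3) (μ ν : Fin 3 → SignedMeasure E3) : Prop :=
  ∀ x ∉ S, magneticField μ x = magneticField ν x

/-- `μ` is `S`-silent if it is `S`-equivalent to the zero magnetization. -/
def IsSilent (S : Set E3) (μ : Fin 3 → SignedMeasure E3) : Prop :=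
  SEquivalent S μ 0

/-- A closed set is slender if it is Lebesgue-null and every connected component of its
complement has infinite Lebesgue measure. -/
structure IsSlender (S : Set E3) : Prop where
  isClosed : IsClosed S
  volume_eq_zero : volume S = 0
  volume_component : ∀ x ∈ Sᶜ, volume (connectedComponentIn Sᶜ x) = ⊤

/-- The field of the zero magnetization vanishes, so that `S`-silent means that the field
vanishes off `S`. -/
theorem magneticField_zero (x : E3) : magneticField 0 x = 0 := by
  ext i
  simp [magneticField]

theorem isSilent_iff (S : Set E3) (μ : Fin 3 → SignedMeasure E3) :
    IsSilent S μ ↔ ∀ x ∉ S, magneticField μ x = 0 := by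
  simp only [IsSilent, SEquivalent, magneticField_zero]

end Magnetization

end

/-!
Write `μ = m ν` with `ν` finite. Up to constants, the field of `μ` off `S` is the gradient of the
potential `Φ x = ∫ ⟪k (x - y), m y⟫ ∂ν`, where `k z = z / ‖z‖ⁿ` is the gradient of the fundamental
solution of the Laplacian, and `Δ Φ` is a nonzero multiple of `div μ` as a distribution. The latter
follows by replacing `‖z‖` with `√(‖z‖² + ε²)`: the divergence of the smooth kernel so obtained is
an approximate identity as `ε → 0`, up to a constant.

If `div μ = 0`, test it against the kernel `y ↦ ⟪k (x - y), v⟫`, smoothly modified near its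
singularity `x ∉ S` and cut off at infinity: the result is the `v`-component of the field at `x`.

Conversely, if the field vanishes off `S`, then `Φ` is constant on every component of `Sᶜ`.
Splitting `k` into an integrable part near `0` and a uniformly small part far from `0` shows that
`{|Φ| ≥ a}` has finite volume for every `a > 0`, so on components of infinite volume that constant
is `0`. Hence `Φ = 0` almost everywhere when `S` is null, and so `div μ = 0`.
-/

noncomputable section

namespace Magnetization

open Filter InnerProductSpace Laplacian Module Topology

section SoftNorm

variable {E : Type*} [NormedAddCommGroup E]

/-- The regularised norm `√(‖z‖² + ε²)`, which is smooth when `ε ≠ 0` and is the norm when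
`ε = 0`. -/
def softNorm (ε : ℝ) (z : E) : ℝ := √(‖z‖ ^ 2 + ε ^ 2)

@[simp] theorem softNorm_zero_left (z : E) : softNorm 0 z = ‖z‖ := by simp [softNorm]

theorem sq_softNorm (ε : ℝ) (z : E) : softNorm ε z ^ 2 = ‖z‖ ^ 2 + ε ^ 2 :=
  Real.sq_sqrt (by positivity)

theorem norm_le_softNorm (ε : ℝ) (z : E) : ‖z‖ ≤ softNorm ε z :=
  Real.le_sqrt_of_sq_le (le_add_of_nonneg_right (sq_nonneg ε))

theorem softNorm_nonneg (ε : ℝ) (z : E) : 0 ≤ softNorm ε z := Real.sqrt_nonneg _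

theorem softNorm_pos {ε : ℝ} {z : E} (h : ε ≠ 0 ∨ z ≠ 0) : 0 < softNorm ε z := by
  rw [softNorm, Real.sqrt_pos]
  rcases h with hε | hz
  · positivity
  · positivity

theorem continuous_softNorm : Continuous fun p : ℝ × E ↦ softNorm p.1 p.2 := by
  unfold softNorm
  fun_prop

theorem softNorm_smul [NormedSpace ℝ E] {ε : ℝ} (hε : 0 ≤ ε) (z : E) :
    softNorm ε (ε • z) = ε * softNorm 1 z := by
  rw [softNorm, softNorm, norm_smul, Real.norm_of_nonneg hε,
    show (ε * ‖z‖) ^ 2 + ε ^ 2 = ε ^ 2 * (‖z‖ ^ 2 + 1 ^ 2) by ring,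
    Real.sqrt_mul (sq_nonneg ε), Real.sqrt_sq hε]

end SoftNorm

section CoulombKernel

variable {E : Type*} [NormedAddCommGroup E] [InnerProductSpace ℝ E]

/-- The Coulomb kernel `z / ‖z‖ⁿ` in dimension `n`, with `‖z‖` replaced by `softNorm ε z`. Up to a
constant, `coulomb 0` is the gradient of the fundamental solution of the Laplacian. -/
def coulomb (ε : ℝ) (z : E) : E := (softNorm ε z ^ finrank ℝ E)⁻¹ • z

/-- The derivative `w ↦ w / ‖z‖ⁿ - n ⟪z, w⟫ z / ‖z‖ⁿ⁺²` of the Coulomb kernel, with `‖z‖` replaced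
by `softNorm ε z`. -/
def coulombDeriv (ε : ℝ) (z : E) : E →L[ℝ] E :=
  (softNorm ε z ^ finrank ℝ E)⁻¹ • .id ℝ E
    - (finrank ℝ E / softNorm ε z ^ (finrank ℝ E + 2)) • (innerSL ℝ z).smulRight z

theorem coulombDeriv_apply (ε : ℝ) (z w : E) :
    coulombDeriv ε z w = (softNorm ε z ^ finrank ℝ E)⁻¹ • w
      - (finrank ℝ E / softNorm ε z ^ (finrank ℝ E + 2) * ⟪z, w⟫_ℝ) • z := by
  simp [coulombDeriv, mul_smul]

theorem inner_coulombDeriv_comm (ε : ℝ) (z v w : E) :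
    ⟪coulombDeriv ε z v, w⟫_ℝ = ⟪coulombDeriv ε z w, v⟫_ℝ := by
  simp only [coulombDeriv_apply, inner_sub_left, real_inner_smul_left, real_inner_comm v w]
  ring

theorem contDiffAt_coulomb {ε : ℝ} {z : E} (h : ε ≠ 0 ∨ z ≠ 0) :
    ContDiffAt ℝ ∞ (coulomb ε) z := by
  have hpos := softNorm_pos h
  have hsoft : ContDiffAt ℝ ∞ (softNorm ε : E → ℝ) z :=
    ((contDiff_norm_sq ℝ).contDiffAt.add contDiffAt_const).sqrt (Real.sqrt_pos.1 hpos).ne'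
  exact ((hsoft.pow _).inv (pow_pos hpos _).ne').smul contDiffAt_id

theorem hasFDerivAt_softNorm {ε : ℝ} {z : E} (h : ε ≠ 0 ∨ z ≠ 0) :
    HasFDerivAt (softNorm ε) ((softNorm ε z)⁻¹ • innerSL ℝ z) z := by
  have hpos := softNorm_pos h
  refine (((hasStrictFDerivAt_norm_sq z).hasFDerivAt.add_const (ε ^ 2)).sqrt
    (Real.sqrt_pos.1 hpos).ne').congr_fderiv ?_
  ext w
  simp only [one_div, mul_inv_rev, smul_apply, coe_innerSL_apply, nsmul_eq_mul,
    Nat.cast_ofNat, smul_eq_mul, softNorm]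
  ring

theorem hasFDerivAt_coulomb {ε : ℝ} {z : E} (h : ε ≠ 0 ∨ z ≠ 0) :
    HasFDerivAt (coulomb ε) (coulombDeriv ε z) z := by
  have hpos := softNorm_pos h
  have hpow := ((hasDerivAt_pow (finrank ℝ E) (softNorm ε z)).inv
    (pow_pos hpos _).ne').comp_hasFDerivAt z (hasFDerivAt_softNorm h)
  refine (hpow.smul (hasFDerivAt_id z)).congr_fderiv ?_
  ext w
  have hcoeff : (finrank ℝ E * softNorm ε z ^ (finrank ℝ E - 1)) / (softNorm ε z ^ finrank ℝ E) ^ 2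
      * (softNorm ε z)⁻¹ = finrank ℝ E / softNorm ε z ^ (finrank ℝ E + 2) := by
    cases finrank ℝ E with
    | zero => simp
    | succ k =>
      rw [Nat.add_sub_cancel]
      field_simp
      ring
  simp [coulombDeriv_apply, ← hcoeff, sub_eq_add_neg, neg_div, mul_assoc]

theorem hasFDerivAt_inner_coulomb {ε : ℝ} {z : E} (h : ε ≠ 0 ∨ z ≠ 0) (v : E) :
    HasFDerivAt (fun z ↦ ⟪coulomb ε z, v⟫_ℝ) (innerSL ℝ (coulombDeriv ε z v)) z := by
  refine ((hasFDerivAt_coulomb h).inner ℝ (hasFDerivAt_const v z)).congr_fderiv ?_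
  ext w
  simp [inner_coulombDeriv_comm ε z w v]

theorem fderiv_inner_coulomb {ε : ℝ} {z : E} (h : ε ≠ 0 ∨ z ≠ 0) (v w : E) :
    fderiv ℝ (fun z ↦ ⟪coulomb ε z, v⟫_ℝ) z w = ⟪coulombDeriv ε z w, v⟫_ℝ := by
  rw [(hasFDerivAt_inner_coulomb h v).fderiv, innerSL_apply_apply, inner_coulombDeriv_comm]

theorem norm_coulomb_le [FiniteDimensional ℝ E] (ε : ℝ) (z : E) :
    ‖coulomb ε z‖ ≤ (‖z‖ ^ (finrank ℝ E - 1))⁻¹ := by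
  rcases eq_or_ne z 0 with rfl | hz
  · simp [coulomb]
  have hsoft := norm_le_softNorm ε z
  rw [coulomb, norm_smul, norm_inv, norm_pow, Real.norm_of_nonneg (softNorm_nonneg ε z)]
  calc (softNorm ε z ^ finrank ℝ E)⁻¹ * ‖z‖ ≤ (‖z‖ ^ finrank ℝ E)⁻¹ * ‖z‖ := by gcongr
    _ = (‖z‖ ^ (finrank ℝ E - 1))⁻¹ := by
      have := nontrivial_of_ne z 0 hz
      rw [← Nat.sub_add_cancel (finrank_pos (R := ℝ) (M := E)), pow_succ, Nat.add_sub_cancel,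
        mul_inv, inv_mul_cancel_right₀ (norm_ne_zero_iff.2 hz)]

theorem norm_coulombDeriv_zero_le (z : E) :
    ‖coulombDeriv 0 z‖ ≤ (finrank ℝ E + 1) / ‖z‖ ^ finrank ℝ E := by
  have hcoeff : finrank ℝ E / ‖z‖ ^ (finrank ℝ E + 2) * (‖z‖ * ‖z‖)
      ≤ finrank ℝ E / ‖z‖ ^ finrank ℝ E := by
    rcases eq_or_ne z 0 with rfl | hz
    · simpa using by positivity
    · exact le_of_eq (by field_simp; ring)
  rw [coulombDeriv, softNorm_zero_left]
  calc _ ≤ (‖z‖ ^ finrank ℝ E)⁻¹ * ‖ContinuousLinearMap.id ℝ E‖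
        + finrank ℝ E / ‖z‖ ^ (finrank ℝ E + 2) * (‖z‖ * ‖z‖) := by
        refine (norm_sub_le _ _).trans_eq ?_
        rw [norm_smul, norm_smul, ContinuousLinearMap.norm_smulRight_apply, innerSL_apply_norm,
          Real.norm_of_nonneg (by positivity), Real.norm_of_nonneg (by positivity)]
    _ ≤ (‖z‖ ^ finrank ℝ E)⁻¹ * 1 + finrank ℝ E / ‖z‖ ^ finrank ℝ E := by
        gcongr
        exact ContinuousLinearMap.norm_id_le
    _ = (finrank ℝ E + 1) / ‖z‖ ^ finrank ℝ E := by ring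

theorem norm_coulomb_le_of_le_norm [FiniteDimensional ℝ E] (ε : ℝ) {r : ℝ} (hr : 0 < r) {z : E}
    (hz : r ≤ ‖z‖) :
    ‖coulomb ε z‖ ≤ (r ^ (finrank ℝ E - 1))⁻¹ :=
  (norm_coulomb_le ε z).trans (by gcongr)

theorem norm_coulombDeriv_zero_le_of_le_norm {r : ℝ} (hr : 0 < r) {z : E} (hz : r ≤ ‖z‖) :
    ‖coulombDeriv 0 z‖ ≤ (finrank ℝ E + 1) / r ^ finrank ℝ E :=
  (norm_coulombDeriv_zero_le z).trans (by gcongr)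

theorem sum_inner_coulombDeriv_self {ι : Type*} [Fintype ι] (b : OrthonormalBasis ι ℝ E) {ε : ℝ}
    {z : E} (h : ε ≠ 0 ∨ z ≠ 0) :
    ∑ i, ⟪coulombDeriv ε z (b i), b i⟫_ℝ
      = finrank ℝ E * ε ^ 2 / softNorm ε z ^ (finrank ℝ E + 2) := by
  have hpos := softNorm_pos h
  have hnorm : ‖z‖ ^ 2 = softNorm ε z ^ 2 - ε ^ 2 := by rw [sq_softNorm]; ring
  have hsum : ∑ i, ⟪z, b i⟫_ℝ * ⟪z, b i⟫_ℝ = ‖z‖ ^ 2 := by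
    simp only [← b.sum_sq_inner_right z, ← sq, real_inner_comm]
  simp only [coulombDeriv_apply, inner_sub_left, real_inner_smul_left, Finset.sum_sub_distrib,
    real_inner_self_eq_norm_sq, b.norm_eq_one, mul_assoc, ← Finset.mul_sum, hsum, hnorm]
  simp only [one_pow, Finset.sum_const, Finset.card_univ, nsmul_eq_mul,
    ← finrank_eq_card_basis b.toBasis]
  field_simp
  ring

/-- The part of the Coulomb kernel within distance `R` of its singularity. -/
def coulombNear (R : ℝ) : E → E := (Metric.ball 0 R).indicator (coulomb 0)

/-- The part of the Coulomb kernel at distance at least `R` from its singularity. -/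
def coulombFar (R : ℝ) : E → E := (Metric.ball 0 R)ᶜ.indicator (coulomb 0)

theorem coulombNear_add_coulombFar (R : ℝ) (z : E) :
    coulombNear R z + coulombFar R z = coulomb 0 z :=
  Set.indicator_self_add_compl_apply _ _ _

theorem norm_coulombFar_le [FiniteDimensional ℝ E] {R : ℝ} (hR : 0 < R) (z : E) :
    ‖coulombFar R z‖ ≤ (R ^ (finrank ℝ E - 1))⁻¹ := by
  by_cases hz : z ∈ Metric.ball (0 : E) R
  · rw [coulombFar, Set.indicator_of_notMem (by simpa using hz), norm_zero]
    positivity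
  · rw [coulombFar, Set.indicator_of_mem hz]
    exact norm_coulomb_le_of_le_norm 0 hR (by simpa using hz)

theorem norm_inner_coulombFar_le [FiniteDimensional ℝ E] {R : ℝ} (hR : 0 < R) (z v : E) :
    ‖⟪coulombFar R z, v⟫_ℝ‖ ≤ (R ^ (finrank ℝ E - 1))⁻¹ * ‖v‖ :=
  (norm_inner_le_norm _ _).trans (by gcongr; exact norm_coulombFar_le hR z)

end CoulombKernel

section SecondDerivative

variable {E F : Type*} [NormedAddCommGroup E] [NormedSpace ℝ E] [NormedAddCommGroup F]
  [NormedSpace ℝ F]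

theorem contDiff_fderiv_apply {φ : E → F} (hφ : ContDiff ℝ 2 φ) (v : E) :
    ContDiff ℝ 1 fun x ↦ fderiv ℝ φ x v :=
  (hφ.fderiv_right (by norm_num)).clm_apply contDiff_const

theorem fderiv_fderiv_apply_comm {φ : E → F} (hφ : ContDiff ℝ 2 φ) (v w x : E) :
    fderiv ℝ (fun y ↦ fderiv ℝ φ y v) x w = fderiv ℝ (fun y ↦ fderiv ℝ φ y w) x v := by
  have hd : DifferentiableAt ℝ (fderiv ℝ φ) x :=
    (hφ.fderiv_right (m := 1) (by norm_num)).differentiable one_ne_zero x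
  simpa [fderiv_clm_apply hd (differentiableAt_const _)] using
    hφ.contDiffAt.isSymmSndFDerivAt (by simp) w v

end SecondDerivative

section FundamentalSolution

variable {E : Type*} [NormedAddCommGroup E] [InnerProductSpace ℝ E] [FiniteDimensional ℝ E]

theorem laplacian_eq_sum_fderiv_fderiv {ι : Type*} [Fintype ι] (b : OrthonormalBasis ι ℝ E)
    {φ : E → ℝ} (hφ : ContDiff ℝ 2 φ) :
    Δ φ = fun x ↦ ∑ i, fderiv ℝ (fun y ↦ fderiv ℝ φ y (b i)) x (b i) := by
  ext x
  have hd : DifferentiableAt ℝ (fderiv ℝ φ) x :=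
    (hφ.fderiv_right (m := 1) (by norm_num)).differentiable one_ne_zero x
  simp [laplacian_eq_iteratedFDeriv_orthonormalBasis φ b, iteratedFDeriv_two_apply,
    fderiv_clm_apply hd (differentiableAt_const _)]

theorem continuous_laplacian {φ : E → ℝ} (hφ : ContDiff ℝ 2 φ) : Continuous (Δ φ) := by
  rw [laplacian_eq_sum_fderiv_fderiv (stdOrthonormalBasis ℝ E) hφ]
  exact continuous_finsetSum _ fun i _ ↦
    ((contDiff_fderiv_apply hφ _).continuous_fderiv one_ne_zero).clm_apply continuous_const

theorem hasCompactSupport_laplacian {φ : E → ℝ} (hφ : HasCompactSupport φ) :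
    HasCompactSupport (Δ φ) := by
  refine hφ.mono' fun x hx ↦ ?_
  contrapose! hx
  have hzero : φ =ᶠ[𝓝 x] fun _ ↦ 0 := notMem_tsupport_iff_eventuallyEq.1 hx
  rw [Function.notMem_support, (laplacian_congr_nhds hzero).eq_of_nhds, laplacian_const]
  rfl

theorem laplacian_comp_add_right (φ : E → ℝ) (y : E) :
    Δ (fun x ↦ φ (x + y)) = fun x ↦ Δ φ (x + y) := by
  ext x
  simp only [laplacian_eq_iteratedFDeriv_stdOrthonormalBasis, iteratedFDeriv_comp_add_right]

variable [MeasurableSpace E] [BorelSpace E]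

theorem integral_mul_fderiv_eq_neg_of_hasCompactSupport {μ : Measure E} [μ.IsAddHaarMeasure]
    {u g : E → ℝ} (hu : ContDiff ℝ 1 u) (hg : ContDiff ℝ 1 g) (hgs : HasCompactSupport g) (v : E) :
    ∫ x, u x * fderiv ℝ g x v ∂μ = -∫ x, fderiv ℝ u x v * g x ∂μ := by
  have hdiff {f : E → ℝ} (hf : ContDiff ℝ 1 f) : Continuous fun x ↦ fderiv ℝ f x v :=
    (hf.continuous_fderiv one_ne_zero).clm_apply continuous_const
  refine integral_mul_fderiv_eq_neg_fderiv_mul_of_integrable ?_ ?_ ?_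
    (fun x _ ↦ hu.differentiable one_ne_zero x) (fun x _ ↦ hg.differentiable one_ne_zero x)
  · exact ((hdiff hu).mul hg.continuous).integrable_of_hasCompactSupport hgs.mul_left
  · exact (hu.continuous.mul (hdiff hg)).integrable_of_hasCompactSupport
      (hgs.fderiv_apply ℝ v).mul_left
  · exact (hu.continuous.mul hg.continuous).integrable_of_hasCompactSupport hgs.mul_left

theorem integral_coulomb_mul_fderiv {ε : ℝ} (hε : ε ≠ 0) {g : E → ℝ} (hg : ContDiff ℝ 1 g)
    (hgs : HasCompactSupport g) (v w : E) :
    ∫ x, ⟪coulomb ε x, v⟫_ℝ * fderiv ℝ g x w = -∫ x, ⟪coulombDeriv ε x w, v⟫_ℝ * g x := by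
  have hu : ContDiff ℝ 1 fun x : E ↦ ⟪coulomb ε x, v⟫_ℝ := contDiff_iff_contDiffAt.2 fun x ↦
    ((contDiffAt_coulomb (.inl hε)).of_le (by simp)).inner ℝ contDiffAt_const
  rw [integral_mul_fderiv_eq_neg_of_hasCompactSupport hu hg hgs]
  simp only [fderiv_inner_coulomb (.inl hε)]

theorem integral_coulomb_mul_fderiv_fderiv {ε : ℝ} (hε : ε ≠ 0) {φ : E → ℝ} (hφ : ContDiff ℝ 2 φ)
    (hs : HasCompactSupport φ) (v w : E) :
    ∫ x, ⟪coulomb ε x, v⟫_ℝ * fderiv ℝ (fun y ↦ fderiv ℝ φ y w) x w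
      = -∫ x, ⟪coulombDeriv ε x w, w⟫_ℝ * fderiv ℝ φ x v := by
  have hd := contDiff_fderiv_apply hφ
  have hds := hs.fderiv_apply ℝ
  rw [integral_coulomb_mul_fderiv hε (hd w) (hds w)]
  simp only [inner_coulombDeriv_comm ε _ w v]
  rw [← integral_coulomb_mul_fderiv hε (hd w) (hds w)]
  simp only [fderiv_fderiv_apply_comm hφ w v]
  exact integral_coulomb_mul_fderiv hε (hd v) (hds v) w w

theorem integral_coulomb_mul_laplacian_of_ne_zero {ε : ℝ} (hε : ε ≠ 0) {φ : E → ℝ}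
    (hφ : ContDiff ℝ 2 φ) (hs : HasCompactSupport φ) (v : E) :
    ∫ x, ⟪coulomb ε x, v⟫_ℝ * Δ φ x
      = -∫ x, finrank ℝ E * ε ^ 2 / softNorm ε x ^ (finrank ℝ E + 2) * fderiv ℝ φ x v := by
  have hd := contDiff_fderiv_apply hφ
  have hds := hs.fderiv_apply ℝ
  have hcoulomb : ContDiff ℝ ∞ (coulomb ε : E → E) :=
    contDiff_iff_contDiffAt.2 fun x ↦ contDiffAt_coulomb (.inl hε)
  have hcoulombDeriv : Continuous (coulombDeriv ε : E → E →L[ℝ] E) := by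
    have hfderiv : fderiv ℝ (coulomb ε : E → E) = coulombDeriv ε :=
      funext fun x ↦ (hasFDerivAt_coulomb (.inl hε)).fderiv
    exact hfderiv ▸ hcoulomb.continuous_fderiv (by simp)
  simp only [laplacian_eq_sum_fderiv_fderiv (stdOrthonormalBasis ℝ E) hφ, Finset.mul_sum,
    ← sum_inner_coulombDeriv_self (stdOrthonormalBasis ℝ E) (.inl hε), Finset.sum_mul]
  rw [integral_finsetSum, integral_finsetSum]
  · simp only [integral_coulomb_mul_fderiv_fderiv hε hφ hs, Finset.sum_neg_distrib]
  · refine fun i _ ↦ Continuous.integrable_of_hasCompactSupport ?_ (hds v).mul_left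
    exact (by fun_prop : Continuous _).mul (hd v).continuous
  · refine fun i _ ↦ Continuous.integrable_of_hasCompactSupport ?_
      ((hds _).fderiv_apply ℝ _).mul_left
    exact (hcoulomb.continuous.inner continuous_const).mul
      (((hd _).continuous_fderiv one_ne_zero).clm_apply continuous_const)

end FundamentalSolution

theorem integrable_div_softNorm_one_pow {E : Type*} [NormedAddCommGroup E] [NormedSpace ℝ E]
    [FiniteDimensional ℝ E] [MeasurableSpace E] [BorelSpace E] (μ : Measure E) [μ.IsAddHaarMeasure]
    (a : ℝ) {k : ℕ} (hk : finrank ℝ E < k) :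
    Integrable (fun w : E ↦ a / softNorm 1 w ^ k) μ := by
  refine ((integrable_rpow_neg_one_add_norm_sq (Nat.cast_lt.2 hk)).const_mul a).congr
    (.of_forall fun w ↦ ?_)
  have hpos : 0 ≤ 1 + ‖w‖ ^ 2 := by positivity
  simp only [softNorm, one_pow, add_comm (‖w‖ ^ 2), Real.sqrt_eq_rpow, div_eq_mul_inv a]
  rw [← Real.rpow_mul_natCast hpos, ← Real.rpow_neg hpos]
  ring_nf

theorem tendsto_integral_mul_comp_smul {E : Type*} [NormedAddCommGroup E] [NormedSpace ℝ E]
    [MeasurableSpace E] [OpensMeasurableSpace E] [SecondCountableTopology E] {μ : Measure E}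
    {k h : E → ℝ} (hk : Integrable k μ) (hh : Continuous h) (hs : HasCompactSupport h) :
    Tendsto (fun ε : ℝ ↦ ∫ w, k w * h (ε • w) ∂μ) (𝓝[>] 0) (𝓝 ((∫ w, k w ∂μ) * h 0)) := by
  obtain ⟨C, hC⟩ := hs.exists_bound_of_continuous hh
  rw [← integral_mul_const]
  refine tendsto_integral_filter_of_dominated_convergence (fun w ↦ ‖k w‖ * C) ?_ ?_
    (hk.norm.mul_const C) (.of_forall fun w ↦ ?_)
  · exact .of_forall fun ε ↦ hk.aestronglyMeasurable.mul
      (hh.comp (continuous_const_smul ε)).aestronglyMeasurable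
  · refine .of_forall fun ε ↦ .of_forall fun w ↦ ?_
    rw [norm_mul]
    gcongr
    exact hC _
  · have hc : Continuous fun ε : ℝ ↦ k w * h (ε • w) := by fun_prop
    simpa using (hc.tendsto 0).mono_left nhdsWithin_le_nhds

section FundamentalSolutionLimit

variable {E : Type*} [NormedAddCommGroup E] [InnerProductSpace ℝ E] [FiniteDimensional ℝ E]
  [MeasurableSpace E] [BorelSpace E]

variable (E) in
/-- The flux of the Coulomb field through a sphere, written as the total mass of the divergence of
`coulomb 1`. -/
def coulombFlux : ℝ := ∫ w : E, finrank ℝ E / softNorm 1 w ^ (finrank ℝ E + 2)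

theorem coulombFlux_pos [Nontrivial E] : 0 < coulombFlux E := by
  have hpos (w : E) : 0 < finrank ℝ E / softNorm 1 w ^ (finrank ℝ E + 2) :=
    div_pos (Nat.cast_pos.2 finrank_pos) (pow_pos (softNorm_pos (.inl one_ne_zero)) _)
  refine (integral_pos_iff_support_of_nonneg (fun w ↦ (hpos w).le)
    (integrable_div_softNorm_one_pow volume _ (by lia))).2 ?_
  rw [Function.support_eq_univ fun w ↦ (hpos w).ne']
  exact Measure.measure_univ_pos.2 (NeZero.ne _)

theorem tendsto_integral_divergence_coulomb {h : E → ℝ} (hh : Continuous h)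
    (hs : HasCompactSupport h) :
    Tendsto (fun ε ↦ ∫ x, finrank ℝ E * ε ^ 2 / softNorm ε x ^ (finrank ℝ E + 2) * h x) (𝓝[>] 0)
      (𝓝 (coulombFlux E * h 0)) := by
  refine (tendsto_integral_mul_comp_smul
    (integrable_div_softNorm_one_pow volume (finrank ℝ E : ℝ) (by lia)) hh hs).congr' ?_
  filter_upwards [self_mem_nhdsWithin] with ε (hε : 0 < ε)
  have hscale := Measure.integral_comp_smul (volume : Measure E)
    (fun x ↦ finrank ℝ E * ε ^ 2 / softNorm ε x ^ (finrank ℝ E + 2) * h x) ε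
  rw [abs_of_pos (by positivity), smul_eq_mul, eq_inv_mul_iff_mul_eq₀ (by positivity)] at hscale
  rw [← hscale, ← integral_const_mul]
  congr with w
  have hpos := softNorm_pos (z := w) (.inl one_ne_zero)
  rw [softNorm_smul hε.le]
  field_simp
  ring

theorem locallyIntegrable_inv_norm_pow {k : ℕ} (hk : k < finrank ℝ E) :
    LocallyIntegrable fun z : E ↦ (‖z‖ ^ k)⁻¹ := by
  refine locallyIntegrable_of_norm_le_rpow (C := 1) (α := k) (by lia) (by exact_mod_cast hk)
    (.of_forall fun z ↦ ?_) (by fun_prop)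
  simp [Real.rpow_neg]

theorem measurable_coulomb (ε : ℝ) : Measurable (coulomb ε : E → E) := by
  unfold coulomb softNorm
  fun_prop

theorem measurable_coulombDeriv_apply (ε : ℝ) :
    Measurable fun p : E × E ↦ coulombDeriv ε p.1 p.2 := by
  simp only [coulombDeriv_apply, softNorm]
  fun_prop

theorem tendsto_integral_coulomb_mul [Nontrivial E] {ψ : E → ℝ} (hψ : Continuous ψ)
    (hs : HasCompactSupport ψ) (v : E) :
    Tendsto (fun ε ↦ ∫ x, ⟪coulomb ε x, v⟫_ℝ * ψ x) (𝓝[>] 0)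
      (𝓝 (∫ x, ⟪coulomb 0 x, v⟫_ℝ * ψ x)) := by
  refine tendsto_integral_filter_of_dominated_convergence
    (fun x ↦ (‖x‖ ^ (finrank ℝ E - 1))⁻¹ * (‖v‖ * |ψ x|)) ?_ ?_ ?_ ?_
  · exact .of_forall fun ε ↦ (((measurable_coulomb ε).inner_const (c := v)).mul
      hψ.measurable).aestronglyMeasurable
  · refine .of_forall fun ε ↦ .of_forall fun x ↦ ?_
    rw [norm_mul, ← mul_assoc]
    gcongr
    · exact (norm_inner_le_norm _ _).trans (by gcongr; exact norm_coulomb_le ε x)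
    · exact le_rfl
  · exact (locallyIntegrable_inv_norm_pow
      (Nat.sub_lt finrank_pos one_pos)).integrable_smul_right_of_hasCompactSupport
      (continuous_const.mul hψ.abs) hs.abs.mul_left
  · filter_upwards [Measure.ae_ne volume (0 : E)] with x hx
    have hsoft : Continuous fun ε ↦ softNorm ε x :=
      continuous_softNorm.comp (Continuous.prodMk_left x)
    have hcoulomb : ContinuousAt (fun ε ↦ coulomb ε x) 0 := ((hsoft.continuousAt.pow _).inv₀
      (pow_pos (softNorm_pos (.inr hx)) _).ne').smul continuousAt_const
    exact ((hcoulomb.inner continuousAt_const).mul continuousAt_const).tendsto.mono_left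
      nhdsWithin_le_nhds

theorem integral_coulomb_mul_laplacian [Nontrivial E] {φ : E → ℝ} (hφ : ContDiff ℝ 2 φ)
    (hs : HasCompactSupport φ) (v y : E) :
    ∫ x, ⟪coulomb 0 (x - y), v⟫_ℝ * Δ φ x = -(coulombFlux E * fderiv ℝ φ y v) := by
  have horigin {f : E → ℝ} (hf : ContDiff ℝ 2 f) (hfs : HasCompactSupport f) :
      ∫ x, ⟪coulomb 0 x, v⟫_ℝ * Δ f x = -(coulombFlux E * fderiv ℝ f 0 v) := by
    refine tendsto_nhds_unique (tendsto_integral_coulomb_mul (continuous_laplacian hf)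
      (hasCompactSupport_laplacian hfs) v) ?_
    refine (tendsto_integral_divergence_coulomb (contDiff_fderiv_apply hf v).continuous
      (hfs.fderiv_apply ℝ v)).neg.congr' ?_
    filter_upwards [self_mem_nhdsWithin] with ε (hε : 0 < ε)
    exact (integral_coulomb_mul_laplacian_of_ne_zero hε.ne' hf hfs v).symm
  have htranslate := horigin (f := fun x ↦ φ (x + y)) (hφ.comp (contDiff_id.add contDiff_const))
    (hs.comp_homeomorph (Homeomorph.addRight y))
  rw [laplacian_comp_add_right, fderiv_comp_add_right, zero_add] at htranslate
  rw [← htranslate, ← integral_add_right_eq_self _ y]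
  simp

end FundamentalSolutionLimit

theorem exists_forall_le_dist_of_notMem {X : Type*} [PseudoMetricSpace X] {S : Set X}
    (hS : IsClosed S) {x₀ : X} (hx₀ : x₀ ∉ S) :
    ∃ r > 0, ∀ y ∈ S, ∀ x ∈ Metric.ball x₀ r, r ≤ dist x y := by
  obtain ⟨d, hd, hdS⟩ := Metric.isOpen_iff.1 hS.isOpen_compl x₀ hx₀
  refine ⟨d / 2, half_pos hd, fun y hy x hx ↦ ?_⟩
  have hdy : d ≤ dist y x₀ := not_lt.1 fun h ↦ hdS (Metric.mem_ball.2 h) hy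
  linarith [dist_triangle y x x₀, dist_comm x y, Metric.mem_ball.1 hx]

section DipolePotential

variable {E : Type*} [NormedAddCommGroup E] [InnerProductSpace ℝ E] [MeasurableSpace E]

/-- The potential at `x` of the dipoles distributed with density `m` with respect to `ν`, up to a
physical constant. -/
def dipolePotential (ν : Measure E) (m : E → E) (x : E) : ℝ := ∫ y, ⟪coulomb 0 (x - y), m y⟫_ℝ ∂ν

/-- The field at `x` of the dipoles distributed with density `m` with respect to `ν`, up to a
physical constant; it is meaningful for `x` outside a closed set carrying `ν`. -/
def dipoleField (ν : Measure E) (m : E → E) (x : E) : E := ∫ y, coulombDeriv 0 (x - y) (m y) ∂ν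

/-- The vector measure with density `m` with respect to `ν` is divergence-free in the sense of
distributions. -/
def IsDivergenceFreeDensity (ν : Measure E) (m : E → E) : Prop :=
  ∀ φ : E → ℝ, ContDiff ℝ ∞ φ → HasCompactSupport φ → ∫ y, fderiv ℝ φ y (m y) ∂ν = 0

variable [FiniteDimensional ℝ E] [BorelSpace E] {ν : Measure E} {m : E → E} {S : Set E}

theorem aestronglyMeasurable_inner_coulomb_sub (hm : AEStronglyMeasurable m ν) (x : E) :
    AEStronglyMeasurable (fun y ↦ ⟪coulomb 0 (x - y), m y⟫_ℝ) ν :=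
  ((measurable_coulomb 0).comp (measurable_const.sub measurable_id)).aestronglyMeasurable.inner hm

theorem aestronglyMeasurable_coulombDeriv_sub_apply (hm : AEStronglyMeasurable m ν) (x : E) :
    AEStronglyMeasurable (fun y ↦ coulombDeriv 0 (x - y) (m y)) ν :=
  ((measurable_coulombDeriv_apply 0).comp_aemeasurable
    ((measurable_const.sub measurable_id).aemeasurable.prodMk hm.aemeasurable)).aestronglyMeasurable

theorem integrable_inner_coulomb_sub (hm : Integrable m ν) (hS : IsClosed S)
    (hν : ∀ᵐ y ∂ν, y ∈ S) {x : E} (hx : x ∉ S) :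
    Integrable (fun y ↦ ⟪coulomb 0 (x - y), m y⟫_ℝ) ν := by
  obtain ⟨r, hr, hdist⟩ := exists_forall_le_dist_of_notMem hS hx
  refine (hm.norm.const_mul (r ^ (finrank ℝ E - 1))⁻¹).mono'
    (aestronglyMeasurable_inner_coulomb_sub hm.1 x) ?_
  filter_upwards [hν] with y hy
  refine (norm_inner_le_norm _ _).trans ?_
  gcongr
  exact norm_coulomb_le_of_le_norm 0 hr (dist_eq_norm x y ▸ hdist y hy x (Metric.mem_ball_self hr))

theorem integrable_coulombDeriv_sub_apply (hm : Integrable m ν) (hS : IsClosed S)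
    (hν : ∀ᵐ y ∂ν, y ∈ S) {x : E} (hx : x ∉ S) :
    Integrable (fun y ↦ coulombDeriv 0 (x - y) (m y)) ν := by
  obtain ⟨r, hr, hdist⟩ := exists_forall_le_dist_of_notMem hS hx
  refine (hm.norm.const_mul ((finrank ℝ E + 1) / r ^ finrank ℝ E)).mono'
    (aestronglyMeasurable_coulombDeriv_sub_apply hm.1 x) ?_
  filter_upwards [hν] with y hy
  refine (ContinuousLinearMap.le_opNorm _ _).trans ?_
  gcongr
  exact norm_coulombDeriv_zero_le_of_le_norm hr
    (dist_eq_norm x y ▸ hdist y hy x (Metric.mem_ball_self hr))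

theorem hasFDerivAt_dipolePotential (hm : Integrable m ν) (hS : IsClosed S)
    (hν : ∀ᵐ y ∂ν, y ∈ S) {x : E} (hx : x ∉ S) :
    HasFDerivAt (dipolePotential ν m) (innerSL ℝ (dipoleField ν m x)) x := by
  obtain ⟨r, hr, hdist⟩ := exists_forall_le_dist_of_notMem hS hx
  have hderiv : HasFDerivAt (dipolePotential ν m)
      (∫ y, innerSL ℝ (coulombDeriv 0 (x - y) (m y)) ∂ν) x := by
    refine hasFDerivAt_integral_of_dominated_of_fderiv_le (Metric.ball_mem_nhds x hr)
      (F' := fun x y ↦ innerSL ℝ (coulombDeriv 0 (x - y) (m y)))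
      (.of_forall fun x ↦ aestronglyMeasurable_inner_coulomb_sub hm.1 x)
      (integrable_inner_coulomb_sub hm hS hν hx)
      ((innerSL ℝ).continuous.comp_aestronglyMeasurable
        (aestronglyMeasurable_coulombDeriv_sub_apply hm.1 x)) ?_
      (hm.norm.const_mul ((finrank ℝ E + 1) / r ^ finrank ℝ E)) ?_
    · filter_upwards [hν] with y hy x' hx'
      rw [innerSL_apply_norm]
      refine (ContinuousLinearMap.le_opNorm _ _).trans ?_
      gcongr
      exact norm_coulombDeriv_zero_le_of_le_norm hr (dist_eq_norm x' y ▸ hdist y hy x' hx')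
    · filter_upwards [hν] with y hy x' hx'
      refine (hasFDerivAt_inner_coulomb (ε := 0) (.inr (norm_pos_iff.1 ?_)) (m y)).comp x'
        ((hasFDerivAt_id x').sub_const y)
      exact dist_eq_norm x' y ▸ hr.trans_le (hdist y hy x' hx')
  rwa [ContinuousLinearMap.integral_comp_comm _
    (integrable_coulombDeriv_sub_apply hm hS hν hx)] at hderiv

theorem integrable_inner_sub_prod [SFinite ν] {k : E → E} (hk : Integrable k)
    (hm : Integrable m ν) :
    Integrable (fun p : E × E ↦ ⟪k (p.1 - p.2), m p.2⟫_ℝ) (volume.prod ν) :=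
  (hm.convolution_integrand (innerSL ℝ) hk).congr (.of_forall fun _ ↦ real_inner_comm _ _)

theorem measurable_coulombFar (R : ℝ) : Measurable (coulombFar R : E → E) :=
  (measurable_coulomb 0).indicator measurableSet_ball.compl

theorem integrable_coulombNear [Nontrivial E] (R : ℝ) : Integrable (coulombNear R : E → E) := by
  rw [coulombNear, integrable_indicator_iff measurableSet_ball]
  have hbound := ((locallyIntegrable_inv_norm_pow
    (Nat.sub_lt finrank_pos one_pos)).integrableOn_isCompact
      (isCompact_closedBall (0 : E) R)).mono_set Metric.ball_subset_closedBall
  exact hbound.mono' (measurable_coulomb 0).aestronglyMeasurable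
    (.of_forall fun z ↦ norm_coulomb_le 0 z)

theorem integrable_inner_coulombFar_sub (hm : Integrable m ν) {R : ℝ} (hR : 0 < R) (x : E) :
    Integrable (fun y ↦ ⟪coulombFar R (x - y), m y⟫_ℝ) ν :=
  (hm.norm.const_mul (R ^ (finrank ℝ E - 1))⁻¹).mono'
    (((measurable_coulombFar R).comp
      (measurable_const.sub measurable_id)).aestronglyMeasurable.inner hm.1)
    (.of_forall fun y ↦ norm_inner_coulombFar_le hR (x - y) (m y))

theorem volume_le_abs_dipolePotential_lt_top [SFinite ν] (hdim : 1 < finrank ℝ E)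
    (hm : Integrable m ν) {a : ℝ} (ha : 0 < a) :
    volume {x | a ≤ |dipolePotential ν m x|} < ⊤ := by
  have : Nontrivial E := nontrivial_of_finrank_pos (one_pos.trans hdim)
  have hdecay : Tendsto (fun R : ℝ ↦ (R ^ (finrank ℝ E - 1))⁻¹ * ∫ y, ‖m y‖ ∂ν) atTop (𝓝 0) := by
    simpa using (tendsto_inv_atTop_zero.comp
      (tendsto_pow_atTop (α := ℝ) (Nat.sub_ne_zero_of_lt hdim))).mul_const (∫ y, ‖m y‖ ∂ν)
  obtain ⟨R, hRa, hR⟩ :=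
    ((hdecay.eventually (gt_mem_nhds (half_pos ha))).and (eventually_gt_atTop 0)).exists
  have hnear := integrable_inner_sub_prod (integrable_coulombNear R) hm
  refine (measure_mono_ae ?_).trans_lt (hnear.integral_prod_left.measure_norm_ge_lt_top
    (half_pos ha))
  filter_upwards [hnear.prod_right_ae] with x hx (hax : a ≤ |dipolePotential ν m x|)
  have hfar : ‖∫ y, ⟪coulombFar R (x - y), m y⟫_ℝ ∂ν‖ ≤ a / 2 := by
    refine (norm_integral_le_of_norm_le (hm.norm.const_mul _)
      (.of_forall fun y ↦ norm_inner_coulombFar_le hR (x - y) (m y))).trans ?_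
    rw [integral_const_mul]
    exact hRa.le
  have hsplit : dipolePotential ν m x = ∫ y, ⟪coulombNear R (x - y), m y⟫_ℝ ∂ν
      + ∫ y, ⟪coulombFar R (x - y), m y⟫_ℝ ∂ν := by
    rw [← integral_add hx (integrable_inner_coulombFar_sub hm hR x)]
    simp only [← inner_add_left, coulombNear_add_coulombFar, dipolePotential]
  change a / 2 ≤ ‖∫ y, ⟪coulombNear R (x - y), m y⟫_ℝ ∂ν‖
  have htriangle := norm_add_le (∫ y, ⟪coulombNear R (x - y), m y⟫_ℝ ∂ν)
    (∫ y, ⟪coulombFar R (x - y), m y⟫_ℝ ∂ν)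
  rw [← hsplit, Real.norm_eq_abs] at htriangle
  linarith

theorem integrable_inner_coulomb_mul_prod [Nontrivial E] [SFinite ν] (hm : Integrable m ν)
    {ψ : E → ℝ} (hψ : Continuous ψ) (hs : HasCompactSupport ψ) :
    Integrable (fun p : E × E ↦ ⟪coulomb 0 (p.1 - p.2), m p.2⟫_ℝ * ψ p.1) (volume.prod ν) := by
  obtain ⟨C, hC⟩ := hs.exists_bound_of_continuous hψ
  have hnear := (integrable_inner_sub_prod (integrable_coulombNear 1) hm).mul_bdd (c := C)
    (g := fun p ↦ ψ p.1) (by fun_prop) (.of_forall fun p ↦ hC p.1)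
  have hfar : Integrable (fun p : E × E ↦ ⟪coulombFar 1 (p.1 - p.2), m p.2⟫_ℝ * ψ p.1)
      (volume.prod ν) := by
    refine ((hψ.integrable_of_hasCompactSupport hs).norm.mul_prod hm.norm).mono'
      ((((measurable_coulombFar 1).comp
        (measurable_fst.sub measurable_snd)).aestronglyMeasurable.inner hm.1.comp_snd).mul
        (by fun_prop)) (.of_forall fun p ↦ ?_)
    have hle := norm_inner_coulombFar_le one_pos (p.1 - p.2) (m p.2)
    rw [one_pow, inv_one, one_mul] at hle
    rw [norm_mul, mul_comm]
    gcongr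
  refine (hnear.add hfar).congr (.of_forall fun p ↦ ?_)
  simp only [Pi.add_apply, ← add_mul, ← inner_add_left, coulombNear_add_coulombFar]

theorem integral_dipolePotential_mul_laplacian [Nontrivial E] [SFinite ν] (hm : Integrable m ν)
    {φ : E → ℝ} (hφ : ContDiff ℝ 2 φ) (hs : HasCompactSupport φ) :
    ∫ x, dipolePotential ν m x * Δ φ x = -(coulombFlux E * ∫ y, fderiv ℝ φ y (m y) ∂ν) :=
  calc ∫ x, dipolePotential ν m x * Δ φ x
      = ∫ x, ∫ y, ⟪coulomb 0 (x - y), m y⟫_ℝ * Δ φ x ∂ν := by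
        simp only [dipolePotential, integral_mul_const]
    _ = ∫ y, (∫ x, ⟪coulomb 0 (x - y), m y⟫_ℝ * Δ φ x) ∂ν :=
        integral_integral_swap (integrable_inner_coulomb_mul_prod hm (continuous_laplacian hφ)
          (hasCompactSupport_laplacian hs))
    _ = -(coulombFlux E * ∫ y, fderiv ℝ φ y (m y) ∂ν) := by
        simp only [integral_coulomb_mul_laplacian hφ hs, integral_neg, integral_const_mul]

end DipolePotential

section SmoothCutoff

variable {E : Type*} [NormedAddCommGroup E] [NormedSpace ℝ E]

theorem fderiv_comp_smul_mul {b g : E → ℝ} (hb : Differentiable ℝ b) (hg : Differentiable ℝ g)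
    (c : ℝ) (y : E) :
    fderiv ℝ (fun y ↦ b (c • y) * g y) y
      = b (c • y) • fderiv ℝ g y + g y • c • fderiv ℝ b (c • y) := by
  have hbc : DifferentiableAt ℝ (fun y ↦ b (c • y)) y := by fun_prop
  rw [fderiv_fun_mul hbc (hg y), fderiv_comp_smul]

theorem norm_fderiv_comp_smul_mul_le {b g : E → ℝ} (hb : Differentiable ℝ b)
    (hg : Differentiable ℝ g) {c : ℝ} (hc : ‖c‖ ≤ 1) {y : E} {K C₀ C₁ : ℝ}
    (hb₀ : ‖b (c • y)‖ ≤ 1) (hb₁ : ‖fderiv ℝ b (c • y)‖ ≤ K) (hg₀ : ‖g y‖ ≤ C₀)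
    (hg₁ : ‖fderiv ℝ g y‖ ≤ C₁) :
    ‖fderiv ℝ (fun y ↦ b (c • y) * g y) y‖ ≤ C₁ + C₀ * K := by
  have hC₀ : 0 ≤ C₀ := (norm_nonneg _).trans hg₀
  calc ‖fderiv ℝ (fun y ↦ b (c • y) * g y) y‖
      ≤ ‖b (c • y)‖ * ‖fderiv ℝ g y‖ + ‖g y‖ * (‖c‖ * ‖fderiv ℝ b (c • y)‖) := by
        rw [fderiv_comp_smul_mul hb hg, ← norm_smul, ← norm_smul, ← norm_smul]
        exact norm_add_le _ _
    _ ≤ 1 * C₁ + C₀ * (1 * K) := by gcongr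
    _ = C₁ + C₀ * K := by ring

theorem exists_contDiff_eventuallyEq_of_contDiffAt_of_ne [HasContDiffBump E] {f : E → ℝ} {x : E}
    (hf : ∀ y ≠ x, ContDiffAt ℝ ∞ f y) {r : ℝ} (hr : 0 < r) :
    ∃ g : E → ℝ, ContDiff ℝ ∞ g ∧ ∀ y, r ≤ dist y x → g =ᶠ[𝓝 y] f := by
  let b : ContDiffBump x := ⟨r / 4, r / 2, by positivity, by linarith⟩
  refine ⟨fun y ↦ (1 - b y) * f y, contDiff_iff_contDiffAt.2 fun y ↦ ?_, fun y hy ↦ ?_⟩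
  · rcases eq_or_ne y x with rfl | hne
    · refine (contDiffAt_const (c := (0 : ℝ))).congr_of_eventuallyEq ?_
      filter_upwards [b.eventuallyEq_one] with z hz
      simp [hz]
    · exact (contDiffAt_const.sub b.contDiff.contDiffAt).mul (hf y hne)
  · have hlt : r / 2 < dist y x := (half_lt_self hr).trans_le hy
    filter_upwards [(isOpen_lt (f := fun _ ↦ r / 2) (g := fun z ↦ dist z x) (by fun_prop)
      (by fun_prop)).mem_nhds hlt] with z hz
    rw [b.zero_of_le_dist (le_of_lt hz), sub_zero, one_mul]

end SmoothCutoff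

theorem exists_contDiff_eq_inner_coulomb_sub {E : Type*} [NormedAddCommGroup E]
    [InnerProductSpace ℝ E] (x v : E) {r : ℝ} (hr : 0 < r) :
    ∃ g : E → ℝ, ContDiff ℝ ∞ g ∧ ∀ y, r ≤ ‖x - y‖ →
      g y = ⟪coulomb 0 (x - y), v⟫_ℝ ∧ fderiv ℝ g y = -innerSL ℝ (coulombDeriv 0 (x - y) v) := by
  have hk : ∀ y ≠ x, ContDiffAt ℝ ∞ (fun y ↦ ⟪coulomb 0 (x - y), v⟫_ℝ) y := fun y hy ↦
    ((contDiffAt_coulomb (.inr (sub_ne_zero.2 hy.symm))).comp y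
      (contDiffAt_const.sub contDiffAt_id)).inner ℝ contDiffAt_const
  obtain ⟨g, hg, hgk⟩ := exists_contDiff_eventuallyEq_of_contDiffAt_of_ne hk hr
  refine ⟨g, hg, fun y hy ↦ ?_⟩
  have hgk' := hgk y (by rwa [dist_comm, dist_eq_norm])
  have hne : x - y ≠ 0 := norm_pos_iff.1 (hr.trans_le hy)
  have hd := (hasFDerivAt_inner_coulomb (ε := 0) (.inr hne) v).comp y
    ((hasFDerivAt_id y).const_sub x)
  exact ⟨hgk'.self_of_nhds, hgk'.fderiv_eq.trans (hd.fderiv.trans (by ext w; simp))⟩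

section SilentOfDivergenceFree

variable {E : Type*} [NormedAddCommGroup E] [InnerProductSpace ℝ E] [FiniteDimensional ℝ E]
  [MeasurableSpace E] [BorelSpace E] {ν : Measure E} {m : E → E} {S : Set E}

theorem IsDivergenceFreeDensity.integral_fderiv_eq_zero (hdiv : IsDivergenceFreeDensity ν m)
    (hm : Integrable m ν) {g : E → ℝ} (hg : ContDiff ℝ ∞ g) {C₀ C₁ : ℝ}
    (hg₀ : ∀ᵐ y ∂ν, ‖g y‖ ≤ C₀) (hg₁ : ∀ᵐ y ∂ν, ‖fderiv ℝ g y‖ ≤ C₁) :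
    ∫ y, fderiv ℝ g y (m y) ∂ν = 0 := by
  let b : ContDiffBump (0 : E) := ⟨1, 2, one_pos, one_lt_two⟩
  have hb : ContDiff ℝ ∞ b := b.contDiff
  have hb' : Continuous (fderiv ℝ b) := hb.continuous_fderiv (by simp)
  obtain ⟨K, hK⟩ := (b.hasCompactSupport.fderiv ℝ).exists_bound_of_continuous hb'
  have hbd := hb.differentiable (by simp)
  have hgd := hg.differentiable (by simp)
  let φ (c : ℝ) (y : E) : ℝ := b (c • y) * g y
  have hφ (c : ℝ) : ContDiff ℝ ∞ (φ c) := (hb.comp (contDiff_const_smul c)).mul hg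
  have hzero : ∀ᶠ c in 𝓝[>] (0 : ℝ), ∫ y, fderiv ℝ (φ c) y (m y) ∂ν = 0 := by
    filter_upwards [self_mem_nhdsWithin] with c (hc : 0 < c)
    exact hdiv _ (hφ c) (b.hasCompactSupport.comp_smul hc.ne').mul_right
  refine tendsto_nhds_unique_of_eventuallyEq (f := fun c ↦ ∫ y, fderiv ℝ (φ c) y (m y) ∂ν)
    (tendsto_integral_filter_of_dominated_convergence
      (fun y ↦ (C₁ + C₀ * K) * ‖m y‖) ?_ ?_ (hm.norm.const_mul _) ?_) tendsto_const_nhds hzero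
  · exact .of_forall fun c ↦ isBoundedBilinearMap_apply.continuous.comp_aestronglyMeasurable
      (((hφ c).continuous_fderiv (by simp)).aestronglyMeasurable.prodMk hm.1)
  · filter_upwards [Ioc_mem_nhdsGT (zero_lt_one' ℝ)] with c ⟨hc₀, hc₁⟩
    filter_upwards [hg₀, hg₁] with y hy₀ hy₁
    refine (ContinuousLinearMap.le_opNorm _ _).trans ?_
    gcongr
    exact norm_fderiv_comp_smul_mul_le hbd hgd (by rwa [Real.norm_of_nonneg hc₀.le])
      (by rw [Real.norm_of_nonneg b.nonneg]; exact b.le_one) (hK _) hy₀ hy₁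
  · refine .of_forall fun y ↦ ?_
    have hφ' : Continuous fun c ↦ fderiv ℝ (φ c) y (m y) := by
      simp only [φ, fderiv_comp_smul_mul hbd hgd]
      have := b.continuous
      fun_prop
    have hφ'₀ : fderiv ℝ (φ 0) y (m y) = fderiv ℝ g y (m y) := by
      simp [φ, b.eventuallyEq_one.self_of_nhds]
    exact hφ'₀ ▸ (hφ'.tendsto 0).mono_left nhdsWithin_le_nhds

theorem IsDivergenceFreeDensity.dipoleField_eq_zero (hdiv : IsDivergenceFreeDensity ν m)
    (hm : Integrable m ν) (hS : IsClosed S) (hν : ∀ᵐ y ∂ν, y ∈ S) {x : E} (hx : x ∉ S) :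
    dipoleField ν m x = 0 := by
  obtain ⟨r, hr, hdist⟩ := exists_forall_le_dist_of_notMem hS hx
  have hle : ∀ᵐ y ∂ν, r ≤ ‖x - y‖ :=
    hν.mono fun y hy ↦ dist_eq_norm x y ▸ hdist y hy x (Metric.mem_ball_self hr)
  refine ext_inner_left ℝ fun v ↦ ?_
  obtain ⟨g, hg, hgk⟩ := exists_contDiff_eq_inner_coulomb_sub x v hr
  have hzero := hdiv.integral_fderiv_eq_zero hm hg
    (C₀ := (r ^ (finrank ℝ E - 1))⁻¹ * ‖v‖) (C₁ := (finrank ℝ E + 1) / r ^ finrank ℝ E * ‖v‖) ?_ ?_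
  · rw [dipoleField, ← integral_inner (integrable_coulombDeriv_sub_apply hm hS hν hx),
      inner_zero_right, ← neg_eq_zero, ← integral_neg]
    refine (integral_congr_ae (hle.mono fun y hy ↦ ?_)).trans hzero
    simp [(hgk y hy).2, inner_coulombDeriv_comm 0 _ v, real_inner_comm]
  · filter_upwards [hle] with y hy
    rw [(hgk y hy).1]
    refine (norm_inner_le_norm _ _).trans ?_
    gcongr
    exact norm_coulomb_le_of_le_norm 0 hr hy
  · filter_upwards [hle] with y hy
    rw [(hgk y hy).2, norm_neg, innerSL_apply_norm]
    refine (ContinuousLinearMap.le_opNorm _ _).trans ?_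
    gcongr
    exact norm_coulombDeriv_zero_le_of_le_norm hr hy

end SilentOfDivergenceFree

section DivergenceFreeOfSilent

variable {E : Type*} [NormedAddCommGroup E] [InnerProductSpace ℝ E] [FiniteDimensional ℝ E]
  [MeasurableSpace E] [BorelSpace E] {ν : Measure E} [SFinite ν] {m : E → E} {S : Set E}

theorem dipolePotential_eq_zero (hdim : 1 < finrank ℝ E) (hm : Integrable m ν) (hS : IsClosed S)
    (hν : ∀ᵐ y ∂ν, y ∈ S) (hfield : ∀ x ∉ S, dipoleField ν m x = 0) {x : E} (hx : x ∉ S)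
    (hvol : volume (connectedComponentIn Sᶜ x) = ⊤) : dipolePotential ν m x = 0 := by
  have hd (z : E) (hz : z ∈ connectedComponentIn Sᶜ x) :
      HasFDerivAt (dipolePotential ν m) (0 : E →L[ℝ] ℝ) z := by
    have hzS := connectedComponentIn_subset _ _ hz
    simpa [hfield z hzS] using hasFDerivAt_dipolePotential hm hS hν hzS
  obtain ⟨a, ha⟩ := hS.isOpen_compl.connectedComponentIn.exists_is_const_of_fderiv_eq_zero
    isPreconnected_connectedComponentIn
    (fun z hz ↦ (hd z hz).differentiableAt.differentiableWithinAt) fun z hz ↦ (hd z hz).fderiv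
  rw [ha x (mem_connectedComponentIn hx)]
  by_contra hne
  refine (volume_le_abs_dipolePotential_lt_top hdim hm (abs_pos.2 hne)).not_ge ?_
  exact hvol ▸ measure_mono fun z hz ↦ (congrArg abs (ha z hz)).ge

theorem isDivergenceFreeDensity_of_dipoleField_eq_zero (hdim : 1 < finrank ℝ E)
    (hm : Integrable m ν) (hS : IsClosed S) (hν : ∀ᵐ y ∂ν, y ∈ S) (hnull : volume S = 0)
    (hvol : ∀ x ∈ Sᶜ, volume (connectedComponentIn Sᶜ x) = ⊤)
    (hfield : ∀ x ∉ S, dipoleField ν m x = 0) : IsDivergenceFreeDensity ν m := by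
  have : Nontrivial E := nontrivial_of_finrank_pos (one_pos.trans hdim)
  intro φ hφ hs
  have hpairing : ∫ x, dipolePotential ν m x * Δ φ x = 0 := by
    refine integral_eq_zero_of_ae ((measure_eq_zero_iff_ae_notMem.1 hnull).mono fun x hx ↦ ?_)
    simp [dipolePotential_eq_zero hdim hm hS hν hfield hx (hvol x hx)]
  rw [integral_dipolePotential_mul_laplacian hm (mod_cast contDiff_infty.1 hφ 2) hs,
    neg_eq_zero] at hpairing
  exact (mul_eq_zero.1 hpairing).resolve_left coulombFlux_pos.ne'

end DivergenceFreeOfSilent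

section SignedMeasureDensity

variable {X G : Type*} [MeasurableSpace X] [NormedAddCommGroup G] [NormedSpace ℝ G]
  {s : SignedMeasure X} {ν : Measure X} [SigmaFinite ν] {f : X → G}

theorem integrable_signedMeasure_rnDeriv_smul (hs : s.totalVariation ≪ ν)
    (hf : Integrable f s.totalVariation) : Integrable (fun x ↦ s.rnDeriv ν x • f x) ν := by
  obtain ⟨hp, hn⟩ := (s.totalVariation_absolutelyContinuous_iff ν).1 hs
  obtain ⟨hfp, hfn⟩ := integrable_add_measure.1 hf
  simp only [SignedMeasure.rnDeriv_def, sub_smul]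
  exact ((integrable_rnDeriv_smul_iff hp).2 hfp).sub ((integrable_rnDeriv_smul_iff hn).2 hfn)

theorem integral_signedMeasure_eq_integral_rnDeriv_smul (hs : s.totalVariation ≪ ν)
    (hf : Integrable f s.totalVariation) : ∫ᵛ x, f x ∂<•s = ∫ x, s.rnDeriv ν x • f x ∂ν := by
  obtain ⟨hp, hn⟩ := (s.totalVariation_absolutelyContinuous_iff ν).1 hs
  obtain ⟨hfp, hfn⟩ := integrable_add_measure.1 hf
  calc ∫ᵛ x, f x ∂<•s
      = ∫ x, f x ∂s.toJordanDecomposition.posPart - ∫ x, f x ∂s.toJordanDecomposition.negPart := by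
        nth_rw 1 [← s.toSignedMeasure_toJordanDecomposition]
        rw [JordanDecomposition.toSignedMeasure, VectorMeasure.integral_sub_vectorMeasure,
          VectorMeasure.integral_toSignedMeasure, VectorMeasure.integral_toSignedMeasure]
        · simpa [VectorMeasure.Integrable] using hfp
        · simpa [VectorMeasure.Integrable] using hfn
    _ = ∫ x, s.rnDeriv ν x • f x ∂ν := by
        rw [← integral_rnDeriv_smul hp, ← integral_rnDeriv_smul hn,
          ← integral_sub ((integrable_rnDeriv_smul_iff hp).2 hfp)
            ((integrable_rnDeriv_smul_iff hn).2 hfn)]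
        simp only [SignedMeasure.rnDeriv_def, sub_smul]

end SignedMeasureDensity

section SignedMeasureField

variable {μ : Fin 3 → SignedMeasure E3} {S : Set E3}

/-- The sum of the total variations of the components of `μ`, which serves as a finite reference
measure. -/
def sumVariation (μ : Fin 3 → SignedMeasure E3) : Measure E3 := ∑ i, (μ i).totalVariation

instance : IsFiniteMeasure (sumVariation μ) := by
  unfold sumVariation
  infer_instance

/-- The density of the vector measure `μ` with respect to `sumVariation μ`. -/
def density (μ : Fin 3 → SignedMeasure E3) (y : E3) : E3 :=
  WithLp.toLp 2 fun i ↦ (μ i).rnDeriv (sumVariation μ) y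

theorem totalVariation_le_sumVariation (μ : Fin 3 → SignedMeasure E3) (i : Fin 3) :
    (μ i).totalVariation ≤ sumVariation μ :=
  Finset.single_le_sum (f := fun i ↦ (μ i).totalVariation) (fun _ _ ↦ Measure.zero_le _)
    (Finset.mem_univ i)

theorem integrable_density (μ : Fin 3 → SignedMeasure E3) :
    Integrable (density μ) (sumVariation μ) :=
  Integrable.of_eval_piLp fun i ↦ (μ i).integrable_rnDeriv (sumVariation μ)

theorem ae_mem_sumVariation (hμ : ∀ i, μ i ∈ signedMeasuresOn S) :
    ∀ᵐ y ∂sumVariation μ, y ∈ S := by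
  rw [ae_iff, sumVariation, Measure.finsetSum_apply]
  exact Finset.sum_eq_zero fun i _ ↦
    measure_mono_null (Set.compl_subset_compl.2 (hμ i)) Measure.measure_compl_support

theorem integrable_density_mul {f : E3 → ℝ} (hf : Integrable f (sumVariation μ)) (i : Fin 3) :
    Integrable (fun y ↦ density μ y i * f y) (sumVariation μ) :=
  integrable_signedMeasure_rnDeriv_smul (totalVariation_le_sumVariation μ i).absolutelyContinuous
    (hf.mono_measure (totalVariation_le_sumVariation μ i))

theorem integral_eq_integral_density_mul {f : E3 → ℝ} (hf : Integrable f (sumVariation μ))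
    (i : Fin 3) : ∫ᵛ y, f y ∂<•(μ i) = ∫ y, density μ y i * f y ∂sumVariation μ :=
  integral_signedMeasure_eq_integral_rnDeriv_smul
    (totalVariation_le_sumVariation μ i).absolutelyContinuous
    (hf.mono_measure (totalVariation_le_sumVariation μ i))

theorem sum_mul_partialDeriv (φ : E3 → ℝ) (y v : E3) :
    ∑ i, v i * partialDeriv i φ y = fderiv ℝ φ y v := by
  nth_rw 2 [← (EuclideanSpace.basisFun (Fin 3) ℝ).sum_repr v]
  simp [partialDeriv]

theorem distribDiv_eq {φ : E3 → ℝ} (hφ : ContDiff ℝ ∞ φ) (hs : HasCompactSupport φ) :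
    distribDiv μ φ = -∫ y, fderiv ℝ φ y (density μ y) ∂sumVariation μ := by
  have hi (i : Fin 3) : Integrable (partialDeriv i φ) (sumVariation μ) :=
    ((hφ.continuous_fderiv (by simp)).clm_apply continuous_const).integrable_of_hasCompactSupport
      (hs.fderiv_apply ℝ _)
  simp only [distribDiv, integral_eq_integral_density_mul (hi _), ← sum_mul_partialDeriv]
  rw [integral_finsetSum _ fun i _ ↦ integrable_density_mul (hi i) i]

theorem isDivergenceFree_iff :
    IsDivergenceFree μ ↔ IsDivergenceFreeDensity (sumVariation μ) (density μ) :=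
  forall₃_congr fun _ hφ hs ↦ by rw [distribDiv_eq hφ hs, neg_eq_zero]

theorem coulombDeriv_zero_apply_apply (z w : E3) (i : Fin 3) :
    coulombDeriv 0 z w i
      = w i * (1 / ‖z‖ ^ 3) - 3 * ∑ j, w j * (z i * z j / ‖z‖ ^ 5) := by
  simp only [coulombDeriv_apply, softNorm_zero_left, finrank_euclideanSpace, Fintype.card_fin,
    Nat.cast_ofNat, Nat.reduceAdd, PiLp.inner_apply, RCLike.inner_apply, Real.ringHom_apply,
    Fin.sum_univ_three, PiLp.sub_apply, PiLp.smul_apply, smul_eq_mul]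
  ring

theorem integrable_one_div_norm_sub_pow (hS : IsClosed S) (hμ : ∀ i, μ i ∈ signedMeasuresOn S)
    {x : E3} (hx : x ∉ S) : Integrable (fun y ↦ 1 / ‖x - y‖ ^ 3) (sumVariation μ) := by
  obtain ⟨r, hr, hdist⟩ := exists_forall_le_dist_of_notMem hS hx
  refine .of_bound (Measurable.aestronglyMeasurable (by fun_prop)) (1 / r ^ 3) ?_
  filter_upwards [ae_mem_sumVariation hμ] with y hy
  rw [Real.norm_of_nonneg (by positivity)]
  gcongr
  exact dist_eq_norm x y ▸ hdist y hy x (Metric.mem_ball_self hr)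

theorem abs_mul_div_norm_pow_le (z : E3) (i j : Fin 3) :
    |z i * z j / ‖z‖ ^ 5| ≤ 1 / ‖z‖ ^ 3 := by
  rw [abs_div, abs_mul, abs_of_nonneg (by positivity : 0 ≤ ‖z‖ ^ 5)]
  calc |z i| * |z j| / ‖z‖ ^ 5 ≤ ‖z‖ * ‖z‖ / ‖z‖ ^ 5 := by
        gcongr
        · exact PiLp.norm_apply_le z i
        · exact PiLp.norm_apply_le z j
    _ = 1 / ‖z‖ ^ 3 := by
        rcases eq_or_ne z 0 with rfl | hz
        · simp
        · field_simp

theorem integrable_mul_div_norm_sub_pow (hS : IsClosed S) (hμ : ∀ i, μ i ∈ signedMeasuresOn S)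
    {x : E3} (hx : x ∉ S) (i j : Fin 3) :
    Integrable (fun y ↦ (x - y) i * (x - y) j / ‖x - y‖ ^ 5) (sumVariation μ) :=
  (integrable_one_div_norm_sub_pow hS hμ hx).mono'
    (Measurable.aestronglyMeasurable (by fun_prop))
    (.of_forall fun y ↦ abs_mul_div_norm_pow_le (x - y) i j)

theorem magneticField_eq (hS : IsClosed S) (hμ : ∀ i, μ i ∈ signedMeasuresOn S) {x : E3}
    (hx : x ∉ S) :
    magneticField μ x = -fieldConst • dipoleField (sumVariation μ) (density μ) x := by
  ext i
  have h₁ := integrable_one_div_norm_sub_pow hS hμ hx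
  have h₂ (j : Fin 3) := integrable_mul_div_norm_sub_pow hS hμ hx i j
  have hint := integrable_coulombDeriv_sub_apply (integrable_density μ) hS
    (ae_mem_sumVariation hμ) hx
  have hcoord : dipoleField (sumVariation μ) (density μ) x i
      = ∫ y, coulombDeriv 0 (x - y) (density μ y) i ∂sumVariation μ :=
    ((EuclideanSpace.proj (𝕜 := ℝ) i).integral_comp_comm hint).symm
  rw [PiLp.smul_apply, smul_eq_mul, hcoord]
  simp only [coulombDeriv_zero_apply_apply]
  rw [integral_sub (integrable_density_mul h₁ i)
    ((integrable_finsetSum _ fun j _ ↦ integrable_density_mul (h₂ j) j).const_mul 3),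
    integral_const_mul, integral_finsetSum _ fun j _ ↦ integrable_density_mul (h₂ j) j]
  simp only [magneticField, integral_eq_integral_density_mul h₁,
    integral_eq_integral_density_mul (h₂ _)]

theorem isSilent_iff_dipoleField_eq_zero (hS : IsClosed S) (hμ : ∀ i, μ i ∈ signedMeasuresOn S) :
    IsSilent S μ ↔ ∀ x ∉ S, dipoleField (sumVariation μ) (density μ) x = 0 := by
  have hc : -fieldConst ≠ 0 := by norm_num [fieldConst]
  rw [isSilent_iff]
  exact forall₂_congr fun x hx ↦ by rw [magneticField_eq hS hμ hx, smul_eq_zero_iff_right hc]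

end SignedMeasureField

end Magnetization

end

theorem mainTheorem4_general {E : Type*} [NormedAddCommGroup E] [InnerProductSpace ℝ E]
    [MeasurableSpace E] [BorelSpace E] [FiniteDimensional ℝ E] (hdim : 1 < Module.finrank ℝ E)
    {ν : Measure E} [SFinite ν] {m : E → E} (hm : Integrable m ν) {S : Set E} (hS : IsClosed S)
    (hν : ∀ᵐ y ∂ν, y ∈ S) :
    (Magnetization.IsDivergenceFreeDensity ν m →
      ∀ x ∉ S, Magnetization.dipoleField ν m x = 0) ∧
    (volume S = 0 → (∀ x ∈ Sᶜ, volume (connectedComponentIn Sᶜ x) = ⊤) →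
      (∀ x ∉ S, Magnetization.dipoleField ν m x = 0) →
      Magnetization.IsDivergenceFreeDensity ν m) :=
  ⟨fun hdiv _ hx ↦ hdiv.dipoleField_eq_zero hm hS hν hx,
    fun hnull hvol hfield ↦ Magnetization.isDivergenceFreeDensity_of_dipoleField_eq_zero
      hdim hm hS hν hnull hvol hfield⟩

theorem mainTheorem4 (S : Set Magnetization.E3) (hS : IsClosed S)
    (μ : Fin 3 → SignedMeasure Magnetization.E3)
    (hμ : ∀ i, μ i ∈ Magnetization.signedMeasuresOn S) :
    (Magnetization.IsDivergenceFree μ → Magnetization.IsSilent S μ) ∧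
    (Magnetization.IsSlender S → Magnetization.IsSilent S μ → Magnetization.IsDivergenceFree μ) := by
  open Magnetization in
  rw [isDivergenceFree_iff, isSilent_iff_dipoleField_eq_zero hS hμ]
  obtain ⟨hsilent, hdiv⟩ := mainTheorem4_general (by simp) (integrable_density μ) hS
    (ae_mem_sumVariation hμ)
  exact ⟨hsilent, fun hslender ↦ hdiv hslender.volume_eq_zero hslender.volume_component⟩
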